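/- **Theorem (Radon–Hurwitz).** Every positive integer $N+1$ (with $N \in \mathbb{N}$, $N \ge 0$) can be written uniquely as $$N+1 = (2t+1)\,2^{4a+b}, \qquad t,a \in \mathbb{N},\ b \in \{0,1,2,3\}.$$ Put $n_N := 8a + 2^b - 1$. Then on the unit sphere $S^N \subset \mathbb{R}^{N+1}$ there exist $n_N$ smooth tangent vector fields that are linearly independent at every point. More precisely, let $n = n_N$, let $\mathbb{R}^{0,n}$ be $\mathbb{R}^n$ with the quadratic form $q(v) = -(v_1^2+\dots+v_n^2)$, and let $\mathcal{G}(\mathbb{R}^{0,n})$ be its geometric (Clifford) algebra, i.e. the tensor algebra modulo the relations $v \otimes v = q(v)$. There is a representation (homomorphism of unital $\mathbb{R}$-algebras) $\rho : \mathcal{G}(\mathbb{R}^{0,n}) \to \mathrm{End}_{\mathbb{R}}(\mathbb{R}^{N+1})$ that acts orthogonally with respect to the standard inner product, that is, $\langle \rho(v)x, \rho(v)y\rangle = \langle x,y\rangle$ for all $x,y\in\mathbb{R}^{N+1}$ and all $v \in \mathbb{R}^{0,n}$ with $v^2=-1$, and such that for every basis $e_1,\dots,e_n$ of $\mathbb{R}^{0,n}$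 the formulas $$V_i(x) = \rho(e_i)x, \qquad x \in S^N,\ i = 1,\dots,n,$$ define smooth tangent vector fields on $S^N$ that are linearly independent at every point of $S^N$. For example, $$\begin{array}{c|ccccccccccccccccc} N & 0&1&2&3&4&5&6&7&8&9&10&11&12&13&14&15&16\\ \hline n_N & 0&1&0&3&0&1&0&7&0&1&0&3&0&1&0&8&0\end{array}$$ **Corollary.** $S^1$, $S^3$ and $S^7$ are parallelizable, i.e. each has a global smooth frame: smooth vector fields whose values at every point form a basis of the tangent space. -/

import Mathlib

open scoped Manifold ContDiff

/-- The unit sphere `S^N` in Euclidean space `ℝ^(N+1)`, with the smooth structure of Mathlib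
(modelled on `𝓡 N`). -/
abbrev UnitSphere (N : ℕ) : Type :=
  Metric.sphere (0 : EuclideanSpace ℝ (Fin (N + 1))) 1

/-- A (not necessarily continuous) section `V` of the tangent bundle of `M` is a smooth vector
field if it is smooth as a map from `M` to its tangent bundle. -/
def IsSmoothVectorField {E H M : Type*} [NormedAddCommGroup E] [NormedSpace ℝ E]
    [TopologicalSpace H] (I : ModelWithCorners ℝ E H) [TopologicalSpace M] [ChartedSpace H M]
    [IsManifold I ∞ M] (V : (x : M) → TangentSpace I x) : Prop :=
  ContMDiff I I.tangent ∞ (fun x => (⟨x, V x⟩ : TangentBundle I M))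

/-- A smooth manifold is parallelizable if it has a global smooth frame: finitely many smooth
vector fields whose values at every point form a basis of the tangent space. -/
def IsParallelizable {E H : Type*} [NormedAddCommGroup E] [NormedSpace ℝ E]
    [TopologicalSpace H] (I : ModelWithCorners ℝ E H) (M : Type*) [TopologicalSpace M]
    [ChartedSpace H M] [IsManifold I ∞ M] : Prop :=
  ∃ V : Fin (Module.finrank ℝ E) → (x : M) → TangentSpace I x,
    (∀ i, IsSmoothVectorField I (V i)) ∧
    ∀ x, LinearIndependent ℝ (fun i => V i x) ∧
      Submodule.span ℝ (Set.range fun i => V i x) = ⊤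

/-- The quadratic form `q(v) = -(v₁² + ⋯ + vₙ²)` of the anti-euclidean space `ℝ^{0,n}`. -/
noncomputable def antiEuclideanForm (n : ℕ) : QuadraticForm ℝ (Fin n → ℝ) :=
  QuadraticMap.weightedSumSquares ℝ (fun _ : Fin n => (-1 : ℝ))

/-- The geometric algebra `𝒢(ℝ^{0,n})`, the quotient of the tensor algebra of `ℝ^{0,n}` by the
relations `v ⊗ v = q(v)`. -/
abbrev GeomAlg (n : ℕ) : Type :=
  CliffordAlgebra (antiEuclideanForm n)

/-- A real representation `ρ` of `𝒢(ℝ^{0,n})` on the inner product space `W` acts orthogonally if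
every vector `v` of `ℝ^{0,n}` with `v² = -1` acts by an orthogonal transformation. -/
def ActsOrthogonally {n : ℕ} {W : Type*} [NormedAddCommGroup W] [InnerProductSpace ℝ W]
    (ρ : GeomAlg n →ₐ[ℝ] Module.End ℝ W) : Prop :=
  ∀ v : Fin n → ℝ, antiEuclideanForm n v = -1 → ∀ x y : W,
    inner ℝ (ρ (CliffordAlgebra.ι (antiEuclideanForm n) v) x)
      (ρ (CliffordAlgebra.ι (antiEuclideanForm n) v) y) = inner ℝ x y

/-! A skew matrix `L` gives the tangent field `x ↦ L x` on the sphere. If the `Jᵢ` are skew, square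
to `-1` and anticommute, then `(∑ vᵢ Jᵢ)² = -|v|²`, so the `Jᵢ` define a Clifford representation. As
`q` is anisotropic, `v ↦ ρ(v) x` is injective for `x ≠ 0`, which gives pointwise independence for
every basis.

It remains to find enough matrices. `isHurwitzRadonFamily_double` merges two mutually commuting
families of sizes `k` and `l` into one of size `k + l + 1` in twice the dimension. It yields 1, 3, 7
structures on `ℝ²`, `ℝ⁴`, `ℝ⁸`. Merging the seven with any family multiplies the dimension by 16 and
adds 8, which is the period in `a`; the odd factor only adds copies. -/

open scoped Kronecker

/-- A Hurwitz–Radon family: pairwise anticommuting skew-symmetric matrices with square `-1`. -/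
structure IsHurwitzRadonFamily {κ ι : Type*} [Fintype ι] [DecidableEq ι]
    (J : κ → Matrix ι ι ℝ) : Prop where
  skew : ∀ i, (J i).transpose = -J i
  sq : ∀ i, J i * J i = -1
  anticomm : ∀ i j, i ≠ j → J i * J j = -(J j * J i)

namespace HurwitzRadon

/-! ### Hurwitz–Radon families of matrices -/

variable {κ κ' ι ι' : Type*} [Fintype ι] [DecidableEq ι] [Fintype ι'] [DecidableEq ι']

/-- The rotation of the plane by a right angle. -/
def rot : Matrix (Fin 2) (Fin 2) ℝ := !![0, -1; 1, 0]

/-- The reflection of the plane that exchanges the coordinates. -/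
def swap : Matrix (Fin 2) (Fin 2) ℝ := !![0, 1; 1, 0]

/-- The reflection of the plane in the first coordinate axis. -/
def refl : Matrix (Fin 2) (Fin 2) ℝ := !![1, 0; 0, -1]

theorem rot_transpose : rot.transpose = -rot := by
  ext i j; fin_cases i <;> fin_cases j <;> simp [rot]

theorem swap_transpose : swap.transpose = swap := by
  ext i j; fin_cases i <;> fin_cases j <;> simp [swap]

theorem refl_transpose : refl.transpose = refl := by
  ext i j; fin_cases i <;> fin_cases j <;> simp [refl]

theorem rot_mul_rot : rot * rot = -1 := by
  ext i j; fin_cases i <;> fin_cases j <;> simp [rot]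

theorem swap_mul_swap : swap * swap = 1 := by
  ext i j; fin_cases i <;> fin_cases j <;> simp [swap]

theorem refl_mul_refl : refl * refl = 1 := by
  ext i j; fin_cases i <;> fin_cases j <;> simp [refl]

theorem swap_mul_rot : swap * rot = -(rot * swap) := by
  ext i j; fin_cases i <;> fin_cases j <;> simp [rot, swap]

theorem refl_mul_rot : refl * rot = -(rot * refl) := by
  ext i j; fin_cases i <;> fin_cases j <;> simp [rot, refl]

theorem refl_mul_swap : refl * swap = -(swap * refl) := by
  ext i j; fin_cases i <;> fin_cases j <;> simp [swap, refl]

theorem neg_kronecker {m n : Type*}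
    (A : Matrix m m ℝ) (B : Matrix n n ℝ) : (-A) ⊗ₖ B = -(A ⊗ₖ B) := by
  ext; simp

theorem kronecker_neg {m n : Type*}
    (A : Matrix m m ℝ) (B : Matrix n n ℝ) : A ⊗ₖ (-B) = -(A ⊗ₖ B) := by
  ext; simp

theorem transpose_kronecker {m n : Type*}
    (A : Matrix m m ℝ) (B : Matrix n n ℝ) :
    (A ⊗ₖ B).transpose = A.transpose ⊗ₖ B.transpose := rfl

/-- The family `rot ⊗ 1, swap ⊗ Jᵢ, refl ⊗ J'ⱼ`. -/
def double (J : κ → Matrix ι ι ℝ) (J' : κ' → Matrix ι ι ℝ) :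
    Option (κ ⊕ κ') → Matrix (Fin 2 × ι) (Fin 2 × ι) ℝ
  | none => rot ⊗ₖ 1
  | some (.inl i) => swap ⊗ₖ J i
  | some (.inr i) => refl ⊗ₖ J' i

/-- `rot`, `swap`, `refl` anticommute pairwise, so factors that commute on the right give
anticommuting products. Within one block `swap² = refl² = 1`, and the relations of `J` or `J'`
survive. -/
theorem isHurwitzRadonFamily_double {J : κ → Matrix ι ι ℝ} {J' : κ' → Matrix ι ι ℝ}
    (hJ : IsHurwitzRadonFamily J) (hJ' : IsHurwitzRadonFamily J')
    (hcomm : ∀ i j, J i * J' j = J' j * J i) : IsHurwitzRadonFamily (double J J') where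
  skew := by
    rintro (_ | i | i) <;>
      simp [double, transpose_kronecker, rot_transpose, swap_transpose, refl_transpose,
        hJ.skew, hJ'.skew, neg_kronecker, kronecker_neg]
  sq := by
    rintro (_ | i | i) <;>
      simp [double, ← Matrix.mul_kronecker_mul, rot_mul_rot, swap_mul_swap, refl_mul_refl,
        hJ.sq, hJ'.sq, neg_kronecker, kronecker_neg]
  anticomm := by
    rintro (_ | i | i) (_ | j | j) h <;>
      simp only [double, ← Matrix.mul_kronecker_mul, swap_mul_rot, refl_mul_rot, refl_mul_swap,
        swap_mul_swap, refl_mul_refl, hcomm, neg_kronecker, one_mul, mul_one, neg_neg]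
    · exact absurd rfl h
    · rw [hJ.anticomm i j (by rintro rfl; exact h rfl), kronecker_neg]
    · rw [hJ'.anticomm i j (by rintro rfl; exact h rfl), kronecker_neg]

theorem isHurwitzRadonFamily_kronecker_one {J : κ → Matrix ι ι ℝ} (hJ : IsHurwitzRadonFamily J) :
    IsHurwitzRadonFamily (fun i => J i ⊗ₖ (1 : Matrix ι' ι' ℝ)) where
  skew i := by simp [transpose_kronecker, hJ.skew, neg_kronecker]
  sq i := by simp [← Matrix.mul_kronecker_mul, hJ.sq, neg_kronecker]
  anticomm i j h := by
    simp only [← Matrix.mul_kronecker_mul, hJ.anticomm i j h, neg_kronecker]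

theorem isHurwitzRadonFamily_one_kronecker {J : κ → Matrix ι ι ℝ} (hJ : IsHurwitzRadonFamily J) :
    IsHurwitzRadonFamily (fun i => (1 : Matrix ι' ι' ℝ) ⊗ₖ J i) where
  skew i := by simp [transpose_kronecker, hJ.skew, kronecker_neg]
  sq i := by simp [← Matrix.mul_kronecker_mul, hJ.sq, kronecker_neg]
  anticomm i j h := by
    simp only [← Matrix.mul_kronecker_mul, hJ.anticomm i j h, kronecker_neg]

theorem isHurwitzRadonFamily_reindex {J : κ → Matrix ι ι ℝ} (hJ : IsHurwitzRadonFamily J)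
    (e : ι' ≃ ι) (f : κ' ≃ κ) :
    IsHurwitzRadonFamily (fun i => (J (f i)).submatrix e e) where
  skew i := by rw [Matrix.transpose_submatrix, hJ.skew]; rfl
  sq i := by rw [Matrix.submatrix_mul_equiv, hJ.sq]; ext; simp [Matrix.one_apply]
  anticomm i j h := by
    rw [Matrix.submatrix_mul_equiv, Matrix.submatrix_mul_equiv,
      hJ.anticomm _ _ (f.injective.ne h)]
    rfl

theorem isHurwitzRadonFamily_of_isEmpty [IsEmpty κ] (J : κ → Matrix ι ι ℝ) :
    IsHurwitzRadonFamily J :=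
  ⟨isEmptyElim, isEmptyElim, isEmptyElim⟩

theorem isHurwitzRadonFamily_rot : IsHurwitzRadonFamily (fun _ : Unit => rot) :=
  ⟨fun _ => rot_transpose, fun _ => rot_mul_rot, fun _ _ h => absurd rfl h⟩

/-- The multiplications by the imaginary units from one side on the quaternions. -/
def quaternionFamily :
    Option (Unit ⊕ Unit) → Matrix (Fin 2 × Fin 2) (Fin 2 × Fin 2) ℝ :=
  double (fun _ : Unit => rot) (fun _ : Unit => rot)

theorem isHurwitzRadonFamily_quaternionFamily : IsHurwitzRadonFamily quaternionFamily :=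
  isHurwitzRadonFamily_double isHurwitzRadonFamily_rot isHurwitzRadonFamily_rot fun _ _ => rfl

/-- The multiplications by the imaginary units from the other side on the quaternions. -/
def quaternionFamilySwap (i : Option (Unit ⊕ Unit)) :
    Matrix (Fin 2 × Fin 2) (Fin 2 × Fin 2) ℝ :=
  (quaternionFamily i).submatrix (Equiv.prodComm _ _) (Equiv.prodComm _ _)

theorem submatrix_prodComm_kronecker {m : Type*} (A B : Matrix m m ℝ) :
    (A ⊗ₖ B).submatrix (Equiv.prodComm m m) (Equiv.prodComm m m) = B ⊗ₖ A := by
  ext; simp [mul_comm]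

/-- For each pair, the two tensor factors either both commute or both anticommute, so the signs
cancel. -/
theorem quaternionFamily_comm (i j : Option (Unit ⊕ Unit)) :
    quaternionFamily i * quaternionFamilySwap j = quaternionFamilySwap j * quaternionFamily i := by
  rcases i with _ | _ | _ <;> rcases j with _ | _ | _ <;>
    simp only [quaternionFamilySwap, quaternionFamily, double, submatrix_prodComm_kronecker,
      ← Matrix.mul_kronecker_mul, swap_mul_rot, refl_mul_rot, neg_kronecker, kronecker_neg,
      mul_one, one_mul]

theorem isHurwitzRadonFamily_quaternionFamilySwap :
    IsHurwitzRadonFamily quaternionFamilySwap :=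
  isHurwitzRadonFamily_reindex isHurwitzRadonFamily_quaternionFamily (Equiv.prodComm _ _)
    (Equiv.refl _)

/-- Seven anticommuting complex structures on `ℝ⁸`. -/
def octonionFamily := double quaternionFamily quaternionFamilySwap

theorem isHurwitzRadonFamily_octonionFamily : IsHurwitzRadonFamily octonionFamily :=
  isHurwitzRadonFamily_double isHurwitzRadonFamily_quaternionFamily
    isHurwitzRadonFamily_quaternionFamilySwap quaternionFamily_comm

theorem exists_isHurwitzRadonFamily_pow (a b : ℕ) (hb : b ≤ 3) :
    ∃ J : Fin (8 * a + 2 ^ b - 1) →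
        Matrix (Fin (2 ^ (4 * a + b))) (Fin (2 ^ (4 * a + b))) ℝ, IsHurwitzRadonFamily J := by
  have of_card : ∀ {κ ι : Type} [Fintype κ] [Fintype ι] [DecidableEq ι] (J : κ → Matrix ι ι ℝ),
      IsHurwitzRadonFamily J → ∀ n m : ℕ, Fintype.card κ = n → Fintype.card ι = m →
      ∃ J : Fin n → Matrix (Fin m) (Fin m) ℝ, IsHurwitzRadonFamily J := by
    rintro κ ι _ _ _ J hJ n m rfl rfl
    exact ⟨_, isHurwitzRadonFamily_reindex hJ (Fintype.equivFin ι).symm (Fintype.equivFin κ).symm⟩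
  induction a with
  | zero =>
    interval_cases b
    · exact ⟨_, isHurwitzRadonFamily_of_isEmpty (κ := Fin 0) fun _ => 0⟩
    · exact of_card _ isHurwitzRadonFamily_rot _ _ rfl rfl
    · exact of_card _ isHurwitzRadonFamily_quaternionFamily _ _ rfl rfl
    · exact of_card _ isHurwitzRadonFamily_octonionFamily _ _ rfl rfl
  | succ a ih =>
    obtain ⟨J, hJ⟩ := ih
    -- Keeps the truncated subtraction in `8 * a + 2 ^ b - 1` exact, so that the count `1 + 7 + n`
    -- is the next one.
    have hpos : 0 < 2 ^ b := by positivity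
    refine of_card _ (isHurwitzRadonFamily_double
      (isHurwitzRadonFamily_kronecker_one isHurwitzRadonFamily_octonionFamily)
      (isHurwitzRadonFamily_one_kronecker hJ) fun i j => ?_) _ _ ?_ ?_
    · simp [← Matrix.mul_kronecker_mul]
    · simp; omega
    · simp; ring

theorem exists_isHurwitzRadonFamily (t a b : ℕ) (hb : b ≤ 3) (m : ℕ)
    (hm : m = (2 * t + 1) * 2 ^ (4 * a + b)) :
    ∃ J : Fin (8 * a + 2 ^ b - 1) → Matrix (Fin m) (Fin m) ℝ, IsHurwitzRadonFamily J := by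
  obtain ⟨J, hJ⟩ := exists_isHurwitzRadonFamily_pow a b hb
  subst hm
  -- The direct sum of `2t + 1` copies.
  exact ⟨_, isHurwitzRadonFamily_reindex
    (isHurwitzRadonFamily_one_kronecker (ι' := Fin (2 * t + 1)) hJ)
    finProdFinEquiv.symm (Equiv.refl _)⟩

/-! ### Vector fields as initial velocities -/

section Flow

variable {E H M : Type*} [NormedAddCommGroup E] [NormedSpace ℝ E] [TopologicalSpace H]
  {I : ModelWithCorners ℝ E H} [TopologicalSpace M] [ChartedSpace H M] [IsManifold I ∞ M]

/-- The initial velocities of a smooth one-parameter family of maps `F (·, t)` with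
`F (·, 0) = id` form a smooth vector field. -/
theorem exists_isSmoothVectorField_of_flow {F : M × ℝ → M}
    (hF : ContMDiff (I.prod 𝓘(ℝ, ℝ)) I ∞ F) (hF0 : ∀ x, F (x, 0) = x) :
    ∃ V : (x : M) → TangentSpace I x, IsSmoothVectorField I V ∧
      ∀ (W : Type) [NormedAddCommGroup W] [NormedSpace ℝ W] (g : M → W)
        (_ : ContMDiff I 𝓘(ℝ, W) ∞ g) (x : M), mfderiv I 𝓘(ℝ, W) g x (V x) = deriv (fun t => g (F (x, t))) 0 := by
  have : IsManifold I 1 M := IsManifold.of_le (n := ∞) (by simp)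
  have hbase : ∀ (x y : M) (w : E), y = x →
      (⟨y, w⟩ : TangentBundle I M) = ⟨x, w⟩ := by
    rintro x _ w rfl
    rfl
  -- The image of `∂/∂t` at `(x, 0)` under the differential of `F`. It lies over `F (x, 0)`, which
  -- `hbase` identifies with `x`; smoothness then comes from the tangent map of `F`.
  let w : M → E := fun x => mfderiv (I.prod 𝓘(ℝ, ℝ)) I F (x, 0) ((0 : E), (1 : ℝ))
  refine ⟨w, ?_, fun W _ _ g hg x => ?_⟩
  · have hs : ContMDiff I (I.prod 𝓘(ℝ, ℝ)).tangent ∞ (fun x : M =>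
        (equivTangentBundleProd I M 𝓘(ℝ, ℝ) ℝ).symm
          (Bundle.zeroSection E (TangentSpace I : M → Type _) x, ⟨0, (1 : ℝ)⟩)) :=
      contMDiff_equivTangentBundleProd_symm.comp
        ((Bundle.contMDiff_zeroSection ℝ (TangentSpace I : M → Type _)).prodMk contMDiff_const)
    have hT := (hF.contMDiff_tangentMap (m := ∞) (by simp)).comp hs
    refine hT.congr fun x => ?_
    exact (hbase x (F (x, 0)) (w x) (hF0 x)).symm
  · have hd := (hasMFDerivAt_const (I := 𝓘(ℝ, ℝ)) (I' := I) x (0 : ℝ)).prodMk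
      (hasMFDerivAt_id (I := 𝓘(ℝ, ℝ)) (0 : ℝ))
    have hFd := (hF.mdifferentiable (by simp) (x, 0)).hasMFDerivAt
    have hgd := (hg.mdifferentiable (by simp) (F (x, 0))).hasMFDerivAt
    have h1 : HasFDerivAt (fun t => g (F (x, t))) (_ : ℝ →L[ℝ] W) 0 :=
      (hgd.comp (0 : ℝ) (hFd.comp (0 : ℝ) hd)).hasFDerivAt
    refine Eq.trans ?_ h1.hasDerivAt.deriv.symm
    exact congrArg (fun y => (mfderiv I 𝓘(ℝ, W) g y : E →L[ℝ] W) (w x)) (hF0 x).symm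

end Flow

/-! ### Normalized curves on the sphere -/

section Curve

variable {E : Type*} [NormedAddCommGroup E] [InnerProductSpace ℝ E]

/-- The curve on the unit sphere through `x` with velocity `L x`, for a skew-adjoint `L`. -/
noncomputable def sphereCurve (L : E →L[ℝ] E) (x : E) (t : ℝ) : E :=
  (Real.sqrt (1 + t ^ 2 * ‖L x‖ ^ 2))⁻¹ • (x + t • L x)

theorem norm_sphereCurve {L : E →L[ℝ] E} (hL : ∀ x, inner ℝ x (L x) = 0) {x : E}
    (hx : ‖x‖ = 1) (t : ℝ) : ‖sphereCurve L x t‖ = 1 := by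
  have h : ‖x + t • L x‖ ^ 2 = 1 + t ^ 2 * ‖L x‖ ^ 2 := by
    rw [norm_add_sq_real, inner_smul_right, hL, hx, norm_smul, mul_pow, Real.norm_eq_abs, sq_abs]
    ring
  have hpos : 0 < 1 + t ^ 2 * ‖L x‖ ^ 2 := by positivity
  rw [sphereCurve, ← h, Real.sqrt_sq (norm_nonneg _), norm_smul, norm_inv, norm_norm,
    inv_mul_cancel₀]
  intro h0
  rw [h0] at h
  simp only [ne_eq, OfNat.ofNat_ne_zero, not_false_eq_true, zero_pow] at h
  exact hpos.ne h

/-- The radicand is positive on all of `E × ℝ`, even off the sphere. -/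
theorem contDiff_sphereCurve (L : E →L[ℝ] E) :
    ContDiff ℝ ∞ (fun p : E × ℝ => sphereCurve L p.1 p.2) := by
  have hpos : ∀ p : E × ℝ, 0 < 1 + p.2 ^ 2 * ‖L p.1‖ ^ 2 := fun p => by positivity
  have h : ContDiff ℝ ∞ (fun p : E × ℝ => 1 + p.2 ^ 2 * ‖L p.1‖ ^ 2) :=
    contDiff_const.add ((contDiff_snd.pow 2).mul ((L.contDiff.comp contDiff_fst).norm_sq ℝ))
  exact ((h.sqrt fun p => (hpos p).ne').inv fun p => (Real.sqrt_pos.2 (hpos p)).ne').smul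
    (contDiff_fst.add (contDiff_snd.smul (L.contDiff.comp contDiff_fst)))

theorem hasDerivAt_sphereCurve (L : E →L[ℝ] E) (x : E) :
    HasDerivAt (sphereCurve L x) (L x) 0 := by
  have h1 : HasDerivAt (fun t : ℝ => 1 + t ^ 2 * ‖L x‖ ^ 2) 0 0 := by
    simpa using (((hasDerivAt_id (0 : ℝ)).pow 2).mul_const (‖L x‖ ^ 2)).const_add 1
  have h2 := (h1.sqrt (by simp)).inv (by simp)
  have h3 : HasDerivAt (fun t : ℝ => x + t • L x) (L x) 0 := by
    simpa using ((hasDerivAt_id (0 : ℝ)).smul_const (L x)).const_add x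
  have h4 := h2.smul h3
  simp only [zero_smul, add_zero, neg_zero, zero_div, ne_eq, OfNat.ofNat_ne_zero,
    not_false_eq_true, zero_pow, zero_mul, Real.sqrt_one, Pi.inv_apply, inv_one, one_smul] at h4
  exact h4

end Curve

/-! ### Skew maps as vector fields on the sphere -/

section Field

variable {N : ℕ}

theorem exists_isSmoothVectorField
    (L : EuclideanSpace ℝ (Fin (N + 1)) →L[ℝ] EuclideanSpace ℝ (Fin (N + 1)))
    (hL : ∀ x, inner ℝ x (L x) = 0) :
    ∃ V : (x : UnitSphere N) → TangentSpace (𝓡 N) x,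
      IsSmoothVectorField (𝓡 N) V ∧ ∀ x : UnitSphere N,
        mfderiv (𝓡 N) 𝓘(ℝ, EuclideanSpace ℝ (Fin (N + 1)))
          (fun y : UnitSphere N => (y : EuclideanSpace ℝ (Fin (N + 1)))) x (V x) = L x := by
  have : Fact (Module.finrank ℝ (EuclideanSpace ℝ (Fin (N + 1))) = N + 1) :=
    ⟨finrank_euclideanSpace_fin⟩
  have hmem : ∀ p : UnitSphere N × ℝ, sphereCurve L p.1 p.2 ∈
      Metric.sphere (0 : EuclideanSpace ℝ (Fin (N + 1))) 1 := fun p =>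
    mem_sphere_zero_iff_norm.2 (norm_sphereCurve hL (norm_eq_of_mem_sphere p.1) _)
  have hF : ContMDiff ((𝓡 N).prod 𝓘(ℝ, ℝ)) (𝓡 N) ∞
      (Set.codRestrict (fun p : UnitSphere N × ℝ => sphereCurve L p.1 p.2) _ hmem) := by
    refine ContMDiff.codRestrict_sphere ?_ hmem
    exact (contDiff_sphereCurve L).contMDiff.comp
      ((contMDiff_coe_sphere.comp contMDiff_fst).prodMk_space contMDiff_snd)
  obtain ⟨V, hV, hV'⟩ := exists_isSmoothVectorField_of_flow hF
    fun x => Subtype.ext (by simp [sphereCurve])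
  refine ⟨V, hV, fun x => ?_⟩
  rw [hV' _ _ contMDiff_coe_sphere]
  exact (hasDerivAt_sphereCurve L x).deriv

end Field

/-! ### Clifford representations and the resulting frames -/

theorem antiEuclideanForm_apply {n : ℕ} (v : Fin n → ℝ) :
    antiEuclideanForm n v = -∑ i, v i ^ 2 := by
  simp [antiEuclideanForm, QuadraticMap.weightedSumSquares_apply, sq]

theorem eq_zero_of_antiEuclideanForm_eq_zero {n : ℕ} {v : Fin n → ℝ}
    (h : antiEuclideanForm n v = 0) : v = 0 := by
  rw [antiEuclideanForm_apply, neg_eq_zero,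
    Finset.sum_eq_zero_iff_of_nonneg fun i _ => sq_nonneg _] at h
  exact funext fun i => pow_eq_zero_iff two_ne_zero |>.1 (h i (Finset.mem_univ i))

variable {n m : ℕ} {J : Fin n → Matrix (Fin m) (Fin m) ℝ}

theorem linearCombination_mul_self (hJ : IsHurwitzRadonFamily J) (v : Fin n → ℝ) :
    Fintype.linearCombination ℝ J v * Fintype.linearCombination ℝ J v =
      algebraMap ℝ _ (antiEuclideanForm n v) := by
  -- Adding the double sum to its transpose cancels the off-diagonal terms and doubles the diagonal.
  have h : ∀ i j, (v i * v j) • (J i * J j) + (v j * v i) • (J j * J i) =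
      if i = j then (-2 * v i ^ 2) • 1 else 0 := by
    intro i j
    split_ifs with hij
    · subst hij
      rw [hJ.sq, ← add_smul, smul_neg, ← neg_smul]
      ring_nf
    · rw [hJ.anticomm i j hij, smul_neg, mul_comm, neg_add_cancel]
  have h2 : (2 : ℝ) • (Fintype.linearCombination ℝ J v * Fintype.linearCombination ℝ J v) =
      (2 : ℝ) • algebraMap ℝ _ (antiEuclideanForm n v) := by
    have hs : Fintype.linearCombination ℝ J v * Fintype.linearCombination ℝ J v =
        ∑ i, ∑ j, (v i * v j) • (J i * J j) := by
      simp only [Fintype.linearCombination_apply, Finset.sum_mul_sum, smul_mul_smul_comm]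
    rw [two_smul]
    nth_rewrite 2 [hs]
    rw [Finset.sum_comm, hs, ← Finset.sum_add_distrib]
    simp only [← Finset.sum_add_distrib, h, Finset.sum_ite_eq, Finset.mem_univ, if_true,
      ← Finset.sum_smul, ← Finset.mul_sum, antiEuclideanForm_apply, Algebra.algebraMap_eq_smul_one,
      smul_smul]
    ring_nf
  exact smul_right_injective _ two_ne_zero h2

/-- The representation of the geometric algebra given by a Hurwitz–Radon family. -/
noncomputable def representation (hJ : IsHurwitzRadonFamily J) :
    GeomAlg n →ₐ[ℝ] Module.End ℝ (EuclideanSpace ℝ (Fin m)) :=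
  (Matrix.toLpLinAlgEquiv 2).toAlgHom.comp
    (CliffordAlgebra.lift (antiEuclideanForm n)
      ⟨Fintype.linearCombination ℝ J, linearCombination_mul_self hJ⟩)

theorem representation_ι (hJ : IsHurwitzRadonFamily J) (v : Fin n → ℝ) :
    representation hJ (CliffordAlgebra.ι (antiEuclideanForm n) v) =
      Matrix.toEuclideanLin (Fintype.linearCombination ℝ J v) := by
  simp only [representation, AlgHom.comp_apply, CliffordAlgebra.lift_ι_apply]
  rfl

theorem representation_ι_sq (hJ : IsHurwitzRadonFamily J) (v : Fin n → ℝ)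
    (x : EuclideanSpace ℝ (Fin m)) :
    representation hJ (CliffordAlgebra.ι (antiEuclideanForm n) v)
      (representation hJ (CliffordAlgebra.ι (antiEuclideanForm n) v) x) =
      antiEuclideanForm n v • x := by
  rw [← Module.End.mul_apply, ← map_mul, CliffordAlgebra.ι_sq_scalar, AlgHom.commutes,
    Module.algebraMap_end_apply]

theorem inner_representation_ι (hJ : IsHurwitzRadonFamily J) (v : Fin n → ℝ)
    (x y : EuclideanSpace ℝ (Fin m)) :
    inner ℝ (representation hJ (CliffordAlgebra.ι (antiEuclideanForm n) v) x) y =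
      -inner ℝ x (representation hJ (CliffordAlgebra.ι (antiEuclideanForm n) v) y) := by
  have h : (Fintype.linearCombination ℝ J v).conjTranspose = -Fintype.linearCombination ℝ J v := by
    simp [Fintype.linearCombination_apply, Matrix.conjTranspose_eq_transpose_of_trivial,
      Matrix.transpose_sum, hJ.skew]
  rw [representation_ι, ← LinearMap.adjoint_inner_right,
    ← Matrix.toEuclideanLin_conjTranspose_eq_adjoint, h, map_neg, LinearMap.neg_apply, inner_neg_right]

theorem actsOrthogonally_representation (hJ : IsHurwitzRadonFamily J) :
    ActsOrthogonally (representation hJ) := by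
  intro v hv x y
  rw [inner_representation_ι, representation_ι_sq, hv, neg_one_smul, inner_neg_right, neg_neg]

theorem linearIndependent_representation_ι (hJ : IsHurwitzRadonFamily J)
    (e : Module.Basis (Fin n) ℝ (Fin n → ℝ)) {x : EuclideanSpace ℝ (Fin m)} (hx : x ≠ 0) :
    LinearIndependent ℝ
      fun i => representation hJ (CliffordAlgebra.ι (antiEuclideanForm n) (e i)) x := by
  let f : (Fin n → ℝ) →ₗ[ℝ] EuclideanSpace ℝ (Fin m) :=
    LinearMap.applyₗ x ∘ₗ (representation hJ).toLinearMap ∘ₗ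
      CliffordAlgebra.ι (antiEuclideanForm n)
  refine e.linearIndependent.map' f (LinearMap.ker_eq_bot'.2 fun v hv => ?_)
  have h := representation_ι_sq hJ v x
  rw [show representation hJ (CliffordAlgebra.ι (antiEuclideanForm n) v) x = 0 from hv, map_zero,
    eq_comm, smul_eq_zero] at h
  exact eq_zero_of_antiEuclideanForm_eq_zero (h.resolve_right hx)

theorem exists_vectorFields {N : ℕ} {J : Fin n → Matrix (Fin (N + 1)) (Fin (N + 1)) ℝ}
    (hJ : IsHurwitzRadonFamily J) (e : Module.Basis (Fin n) ℝ (Fin n → ℝ)) :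
    ∃ V : Fin n → (x : UnitSphere N) → TangentSpace (𝓡 N) x,
      (∀ i, IsSmoothVectorField (𝓡 N) (V i)) ∧
      (∀ x, LinearIndependent ℝ (fun i => V i x)) ∧
      ∀ (i : Fin n) (x : UnitSphere N),
        mfderiv (𝓡 N) 𝓘(ℝ, EuclideanSpace ℝ (Fin (N + 1)))
            (fun y : UnitSphere N => (y : EuclideanSpace ℝ (Fin (N + 1)))) x (V i x) =
          representation hJ (CliffordAlgebra.ι (antiEuclideanForm n) (e i))
            (x : EuclideanSpace ℝ (Fin (N + 1))) := by
  have hskew : ∀ i x, inner ℝ x (LinearMap.toContinuousLinearMap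
      (representation hJ (CliffordAlgebra.ι (antiEuclideanForm n) (e i))) x) = 0 := by
    intro i x
    have h := inner_representation_ι hJ (e i) x x
    rw [real_inner_comm] at h
    exact self_eq_neg.1 h
  choose V hV hV' using fun i => exists_isSmoothVectorField _ (hskew i)
  refine ⟨V, hV, fun x => ?_, hV'⟩
  let A : EuclideanSpace ℝ (Fin N) →L[ℝ] EuclideanSpace ℝ (Fin (N + 1)) :=
    mfderiv (𝓡 N) 𝓘(ℝ, EuclideanSpace ℝ (Fin (N + 1)))
      (fun y : UnitSphere N => (y : EuclideanSpace ℝ (Fin (N + 1)))) x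
  let u : Fin n → EuclideanSpace ℝ (Fin N) := fun i => V i x
  have hA : A.toLinearMap ∘ u = fun i =>
      representation hJ (CliffordAlgebra.ι (antiEuclideanForm n) (e i))
        (x : EuclideanSpace ℝ (Fin (N + 1))) := funext fun i => hV' i x
  -- Independence of the images under the linear map `A` suffices; `A` need not be known to be
  -- injective.
  have hu : LinearIndependent ℝ u := by
    refine LinearIndependent.of_comp A.toLinearMap ?_
    rw [hA]
    exact linearIndependent_representation_ι hJ e (ne_zero_of_mem_unit_sphere x)
  exact hu

theorem isParallelizable_unitSphere {N : ℕ} {J : Fin N → Matrix (Fin (N + 1)) (Fin (N + 1)) ℝ}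
    (hJ : IsHurwitzRadonFamily J) : IsParallelizable (𝓡 N) (UnitSphere N) := by
  obtain ⟨V, hV, hli, -⟩ := exists_vectorFields hJ (Pi.basisFun ℝ (Fin N))
  have hN : Module.finrank ℝ (EuclideanSpace ℝ (Fin N)) = N := finrank_euclideanSpace_fin
  refine ⟨fun i => V (Fin.cast hN i), fun i => hV _, fun x => ?_⟩
  have h : LinearIndependent ℝ fun i => V (Fin.cast hN i) x :=
    (hli x).comp _ (Fin.cast_injective hN)
  have : FiniteDimensional ℝ (TangentSpace (𝓡 N) x) :=
    inferInstanceAs (FiniteDimensional ℝ (EuclideanSpace ℝ (Fin N)))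
  exact ⟨h, h.span_eq_top_of_card_eq_finrank' (Fintype.card_fin _)⟩

/-! ### Arithmetic of the decomposition -/

theorem existsUnique_odd_mul_pow (N : ℕ) : ∃! p : ℕ × ℕ × Fin 4,
    N + 1 = (2 * p.1 + 1) * 2 ^ (4 * p.2.1 + (p.2.2 : ℕ)) := by
  obtain ⟨k, m, hm, hN⟩ := Nat.exists_eq_two_pow_mul_odd N.succ_ne_zero
  obtain ⟨t, rfl⟩ := hm
  refine ⟨(t, k / 4, ⟨k % 4, Nat.mod_lt _ (by norm_num)⟩), ?_, ?_⟩
  · simp only [Nat.div_add_mod]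
    rw [mul_comm, ← hN]
  · rintro ⟨t', a, b⟩ h
    -- If `k' < k`, cancelling `2 ^ k'` equates an even number with an odd one.
    have key : ∀ {s s' k k' : ℕ}, (2 * s + 1) * 2 ^ k = (2 * s' + 1) * 2 ^ k' → k ≤ k' := by
      intro s s' k k' h
      by_contra! hlt
      obtain ⟨d, rfl⟩ := Nat.exists_eq_add_of_lt hlt
      have h' : (2 * ((2 * s + 1) * 2 ^ d)) * 2 ^ k' = (2 * s' + 1) * 2 ^ k' := by
        rw [← h]; ring
      have := Nat.eq_of_mul_eq_mul_right (by positivity) h'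
      omega
    have h' : (2 * t' + 1) * 2 ^ (4 * a + (b : ℕ)) = (2 * t + 1) * 2 ^ k := by
      rw [← h, mul_comm (2 * t + 1)]
      exact hN
    have hk : 4 * a + (b : ℕ) = k := le_antisymm (key h') (key h'.symm)
    rw [hk] at h'
    have ht := Nat.eq_of_mul_eq_mul_right (by positivity) h'
    have hb := b.isLt
    simp only [Prod.mk.injEq, Fin.ext_iff]
    omega

end HurwitzRadon

theorem mainTheorem2 :
    -- every `N + 1` is uniquely of the form `(2t+1) 2^(4a+b)` with `b ∈ {0,1,2,3}`
    (∀ N : ℕ, ∃! p : ℕ × ℕ × Fin 4,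
      N + 1 = (2 * p.1 + 1) * 2 ^ (4 * p.2.1 + (p.2.2 : ℕ))) ∧
    -- the vector fields on `S^N`, obtained from an orthogonal representation on `ℝ^(N+1)`
    (∀ N t a b n : ℕ, b ≤ 3 → N + 1 = (2 * t + 1) * 2 ^ (4 * a + b) → n = 8 * a + 2 ^ b - 1 →
      ∃ ρ : GeomAlg n →ₐ[ℝ] Module.End ℝ (EuclideanSpace ℝ (Fin (N + 1))),
        ActsOrthogonally ρ ∧
        ∀ e : Module.Basis (Fin n) ℝ (Fin n → ℝ),
          ∃ V : Fin n → (x : UnitSphere N) → TangentSpace (𝓡 N) x,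
            (∀ i, IsSmoothVectorField (𝓡 N) (V i)) ∧
            (∀ x, LinearIndependent ℝ (fun i => V i x)) ∧
            -- under the inclusion `S^N ⊆ ℝ^(N+1)`, the vector `V i x` is `ρ(eᵢ) x`
            (∀ (i : Fin n) (x : UnitSphere N),
              mfderiv (𝓡 N) 𝓘(ℝ, EuclideanSpace ℝ (Fin (N + 1)))
                  (fun y : UnitSphere N => (y : EuclideanSpace ℝ (Fin (N + 1)))) x (V i x) =
                ρ (CliffordAlgebra.ι (antiEuclideanForm n) (e i))
                  (x : EuclideanSpace ℝ (Fin (N + 1))))) ∧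
    -- the table of the numbers `n_N` for `N = 0, …, 16`
    (∀ N : Fin 17, ∃ t a b : ℕ, b ≤ 3 ∧ (N : ℕ) + 1 = (2 * t + 1) * 2 ^ (4 * a + b) ∧
      8 * a + 2 ^ b - 1 =
        (![0, 1, 0, 3, 0, 1, 0, 7, 0, 1, 0, 3, 0, 1, 0, 8, 0] : Fin 17 → ℕ) N) ∧
    -- parallelizability of `S^1`, `S^3` and `S^7`
    IsParallelizable (𝓡 1) (UnitSphere 1) ∧
    IsParallelizable (𝓡 3) (UnitSphere 3) ∧
    IsParallelizable (𝓡 7) (UnitSphere 7) := by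
  refine ⟨HurwitzRadon.existsUnique_odd_mul_pow, ?_, ?_, ?_, ?_, ?_⟩
  · rintro N t a b n hb hN rfl
    obtain ⟨J, hJ⟩ := HurwitzRadon.exists_isHurwitzRadonFamily t a b hb _ hN
    exact ⟨HurwitzRadon.representation hJ, HurwitzRadon.actsOrthogonally_representation hJ,
      HurwitzRadon.exists_vectorFields hJ⟩
  · intro N
    -- Since `N + 1 ≤ 17`, these bounds lose no solution and make the search finite.
    have h : ∀ N : Fin 17, ∃ t < 9, ∃ a < 2, ∃ b < 4,
        (N : ℕ) + 1 = (2 * t + 1) * 2 ^ (4 * a + b) ∧ 8 * a + 2 ^ b - 1 =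
          (![0, 1, 0, 3, 0, 1, 0, 7, 0, 1, 0, 3, 0, 1, 0, 8, 0] : Fin 17 → ℕ) N := by
      decide
    obtain ⟨t, -, a, -, b, hb, h⟩ := h N
    exact ⟨t, a, b, Nat.le_of_lt_succ hb, h⟩
  · obtain ⟨J, hJ⟩ := HurwitzRadon.exists_isHurwitzRadonFamily 0 0 1 (by norm_num) 2 rfl
    exact HurwitzRadon.isParallelizable_unitSphere hJ
  · obtain ⟨J, hJ⟩ := HurwitzRadon.exists_isHurwitzRadonFamily 0 0 2 (by norm_num) 4 rfl
    exact HurwitzRadon.isParallelizable_unitSphere hJ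
  · obtain ⟨J, hJ⟩ := HurwitzRadon.exists_isHurwitzRadonFamily 0 0 3 (by norm_num) 8 rfl
    exact HurwitzRadon.isParallelizable_unitSphere hJ
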